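/- Let $a<a_1<b_1<b$, $\Omega=(a,b)$, $\Omega_1=(a_1,b_1)$, $\Omega_2=(a,a_1)\cup(b_1,b)$. Let $\alpha,\beta,\gamma>0$ and $\kappa\ge 0$ be constants, $h,q\in L^2(\Omega)$ and $g\in H^1(\Omega)$. Let $u_0\in H^1(\Omega)$ be the solution of the two-sided problem with Robin transmission condition: writing $u_1=u_0|_{\Omega_1}$, $u_2=u_0|_{\Omega_2}$, $$-u_1''+\gamma u_1=q\ \text{ in }\Omega_1,\qquad -\alpha u_2''+\beta u_2=h\ \text{ in }\Omega_2,$$ $$u_1=u_2\ \text{ and }\ -(u_1'-\alpha u_2')\,n_1=\kappa u_1+g\ \text{ on }\partial\Omega_1=\{a_1,b_1\},\qquad \alpha u_2'\,n_2=0\ \text{ on }\partial\Omega=\{a,b\},$$ where $n_1(a_1)=-1$, $n_1(b_1)=1$, $n_2(a)=-1$, $n_2(b)=1$; the equations hold almost everywhere with weak second derivatives, and boundary values are those of the continuous representatives. For $\varepsilon\in(0,1)$ let $\phi_\varepsilon(x)=\frac12\left[1+\tanh\left(r(x)/\varepsilon\right)\right]$, where $r$ is the signed distance to $\partial\Omega_1$,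 positive in $\Omega_1$ and negative outside $\overline{\Omega_1}$, and put $D_\varepsilon=\alpha+(1-\alpha)\phi_\varepsilon$, $c_\varepsilon=\beta+(\gamma-\beta)\phi_\varepsilon$, $f_\varepsilon=h+(q-h)\phi_\varepsilon$. Let $u_\varepsilon\in H^1(\Omega)$ be the solution of the diffuse domain problem, i.e. $$\int_\Omega\left(D_\varepsilon u_\varepsilon' v'+c_\varepsilon u_\varepsilon v+(\kappa u_\varepsilon+g)|\phi_\varepsilon'|\,v\right)dx=\int_\Omega f_\varepsilon v\,dx\qquad\text{for all }v\in H^1(\Omega).$$ Then for every sequence $(\varepsilon_k)\subset(0,1)$ with $\varepsilon_k\to0$ there is a subsequence of $(u_{\varepsilon_k})$ that converges strongly to $u_0$ in $H^1(\Omega)$. -/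

import Mathlib

open MeasureTheory Set Filter Topology
open scoped ContDiff

noncomputable section

namespace DiffuseDomain

/-- `w'` is the weak (distributional) derivative of `w` on the open set `Ω ⊆ ℝ`. -/
structure HasWeakDeriv (Ω : Set ℝ) (w w' : ℝ → ℝ) : Prop where
  locInt : LocallyIntegrableOn w Ω
  locInt_deriv : LocallyIntegrableOn w' Ω
  integral_eq : ∀ ψ : ℝ → ℝ, ContDiff ℝ ∞ ψ → HasCompactSupport ψ → tsupport ψ ⊆ Ω →
    ∫ x in Ω, w x * deriv ψ x = - ∫ x in Ω, w' x * ψ x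

/-- An element of the Sobolev space `H¹(Ω)`: a function in `L²(Ω)` together with its weak
derivative in `L²(Ω)`. Functions are represented by functions on `ℝ`, of which only the
almost-everywhere class on `Ω` matters. -/
structure H1 (Ω : Set ℝ) where
  toFun : ℝ → ℝ
  grad : ℝ → ℝ
  memLp : MemLp toFun 2 (volume.restrict Ω)
  memLp_grad : MemLp grad 2 (volume.restrict Ω)
  hasWeakDeriv : HasWeakDeriv Ω toFun grad

instance (Ω : Set ℝ) : CoeFun (H1 Ω) (fun _ => ℝ → ℝ) := ⟨H1.toFun⟩

/-- `‖u - v‖_{H¹(Ω)}`. -/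
def H1.dist {Ω : Set ℝ} (u v : H1 Ω) : ℝ :=
  Real.sqrt ((∫ x in Ω, (u x - v x) ^ 2) + ∫ x in Ω, (u.grad x - v.grad x) ^ 2)

/-- `w` is a representative, continuous on the closure of `Ω`, of the almost-everywhere class
of `v` on `Ω`; its values at boundary or interface points are the traces of `v`. -/
def IsContRep (Ω : Set ℝ) (v w : ℝ → ℝ) : Prop :=
  ContinuousOn w (closure Ω) ∧ w =ᵐ[volume.restrict Ω] v

/-- The data of the problem in one dimension. -/
structure Data where
  (a a₁ b₁ b : ℝ)
  (α β γ κ : ℝ)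
  (h q : ℝ → ℝ)
  g : H1 (Ioo a b)
  a_lt : a < a₁
  a₁_lt : a₁ < b₁
  b₁_lt : b₁ < b
  α_pos : 0 < α
  β_pos : 0 < β
  γ_pos : 0 < γ
  κ_nonneg : 0 ≤ κ
  h_memLp : MemLp h 2 (volume.restrict (Ioo a b))
  q_memLp : MemLp q 2 (volume.restrict (Ioo a b))

namespace Data

variable (P : Data)

/-- The whole domain `Ω = (a, b)`. -/
def Ω : Set ℝ := Ioo P.a P.b

/-- The inner domain `Ω₁ = (a₁, b₁)`. -/
def Ω₁ : Set ℝ := Ioo P.a₁ P.b₁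

/-- The outer domain `Ω₂ = (a, a₁) ∪ (b₁, b)`. -/
def Ω₂ : Set ℝ := Ioo P.a P.a₁ ∪ Ioo P.b₁ P.b

open Classical in
/-- The signed distance to `∂Ω₁`, positive in `Ω₁`, negative outside its closure. -/
def r (x : ℝ) : ℝ :=
  if x ∈ P.Ω₁ then Metric.infDist x (frontier P.Ω₁) else - Metric.infDist x (frontier P.Ω₁)

/-- The phase-field function. -/
def φ (ε x : ℝ) : ℝ := (1 / 2) * (1 + Real.tanh (P.r x / ε))

def D (ε x : ℝ) : ℝ := P.α + (1 - P.α) * P.φ ε x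

def c (ε x : ℝ) : ℝ := P.β + (P.γ - P.β) * P.φ ε x

def f (ε x : ℝ) : ℝ := P.h x + (P.q x - P.h x) * P.φ ε x

/-- `u ∈ H¹(Ω)` is the (weak) solution of the diffuse domain problem
`-(D_ε u')' + c_ε u + (κ u + g) |φ_ε'| = f_ε` in `Ω`, `D_ε u' = 0` on `∂Ω`.
The function `φ_ε` is Lipschitz and differentiable off the midpoint of `Ω₁`. -/
def IsDiffuseSolution (ε : ℝ) (u : H1 P.Ω) : Prop :=
  ∀ v : H1 P.Ω,
    ∫ x in P.Ω, (P.D ε x * u.grad x * v.grad x + P.c ε x * u x * v x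
        + (P.κ * u x + P.g x) * |deriv (P.φ ε) x| * v x)
      = ∫ x in P.Ω, P.f ε x * v x

/-- `u ∈ H¹(Ω)` is the solution of the two-sided problem, with `u₁ = u|_{Ω₁}`, `u₂ = u|_{Ω₂}`.
The equations hold with weak second derivatives. The functions `u₁'` and `u₂'` then have
continuous representatives `p₁`, `p₂` up to the boundary, which give the fluxes on `∂Ω₁` and `∂Ω`;
the values of `u` and `g` on `∂Ω₁` are those of their continuous representatives `w`, `gc`. The
condition `u₁ = u₂` on `∂Ω₁` is the continuity of `w` on the closure of `Ω`. The outward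
normals are `-1` at `a₁` and `a`, and `1` at `b₁` and `b`. -/
def IsTwoSidedSolution (u : H1 P.Ω) : Prop :=
  (∃ u₁'' : ℝ → ℝ, HasWeakDeriv P.Ω₁ u.grad u₁'' ∧
    ∀ᵐ x ∂(volume.restrict P.Ω₁), - u₁'' x + P.γ * u x = P.q x) ∧
  (∃ u₂'' : ℝ → ℝ, HasWeakDeriv P.Ω₂ u.grad u₂'' ∧
    ∀ᵐ x ∂(volume.restrict P.Ω₂), - P.α * u₂'' x + P.β * u x = P.h x) ∧
  ∃ w gc p₁ p₂ : ℝ → ℝ,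
    IsContRep P.Ω u w ∧ IsContRep P.Ω P.g gc ∧
    IsContRep P.Ω₁ u.grad p₁ ∧ IsContRep P.Ω₂ u.grad p₂ ∧
    - (p₁ P.a₁ - P.α * p₂ P.a₁) * (-1) = P.κ * w P.a₁ + gc P.a₁ ∧
    - (p₁ P.b₁ - P.α * p₂ P.b₁) * 1 = P.κ * w P.b₁ + gc P.b₁ ∧
    P.α * p₂ P.a * (-1) = 0 ∧
    P.α * p₂ P.b * 1 = 0

end Data

end DiffuseDomain

end

/-!
The coefficients `D`, `c` and `f` are affine in `φ ε`, so the residual of `u₀` in the weak form of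
the diffuse problem consists of integrals weighted by `φ ε - χ`, where `χ` is the indicator of
`Ω₁`, and of the error made when the weight `|deriv (φ ε)|` stands in for Dirac masses at `a₁` and
`b₁`. Since `φ ε` is monotone on either side of the midpoint of `Ω₁`, an integration by parts on
each side turns this error into further integrals weighted by `φ ε - χ` and the deviations of
`φ ε` from `χ` at `a`, at the midpoint and at `b`. By dominated convergence and the embedding of
`H¹` into the continuous functions, all of these tend to zero in the dual of `H¹`, and as
`D`, `c` are bounded below uniformly in `ε`, so does the `H¹` distance of the solutions. The whole
family converges; no compactness is needed.
-/

namespace DiffuseDomain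

/-- `W` is an absolutely continuous primitive of `w` on `[a, b]`. Elements of `H¹(a, b)` are handled
through their primitive representatives, whose values at single points make sense. -/
structure IsPrimitiveOn (a b : ℝ) (W w : ℝ → ℝ) : Prop where
  le : a ≤ b
  intervalIntegrable : IntervalIntegrable w volume a b
  eq_add : ∀ x ∈ Icc a b, W x = W a + ∫ t in a..x, w t

lemma isPrimitiveOn_integral {a b : ℝ} {f : ℝ → ℝ} (hab : a ≤ b)
    (hf : IntervalIntegrable f volume a b) (C : ℝ) :
    IsPrimitiveOn a b (fun x => C + ∫ t in a..x, f t) f :=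
  ⟨hab, hf, by simp⟩

namespace IsPrimitiveOn

variable {a b c d : ℝ} {F G f g : ℝ → ℝ}

lemma integrableOn (hF : IsPrimitiveOn a b F f) : IntegrableOn f (Ioo a b) :=
  (intervalIntegrable_iff_integrableOn_Ioo_of_le hF.le).1 hF.intervalIntegrable

lemma sub_eq (hF : IsPrimitiveOn a b F f) {x y : ℝ} (hx : x ∈ Icc a b) (hy : y ∈ Icc a b) :
    F y - F x = ∫ t in x..y, f t := by
  have hint : ∀ z ∈ Icc a b, IntervalIntegrable f volume a z := fun z hz =>
    hF.intervalIntegrable.mono_set (uIcc_subset_uIcc_left (by rwa [uIcc_of_le hF.le]))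
  rw [hF.eq_add x hx, hF.eq_add y hy,
    ← intervalIntegral.integral_interval_sub_left (hint y hy) (hint x hx)]
  ring

lemma mono (hF : IsPrimitiveOn a b F f) (hac : a ≤ c) (hcd : c ≤ d) (hdb : d ≤ b) :
    IsPrimitiveOn c d F f where
  le := hcd
  intervalIntegrable := hF.intervalIntegrable.mono_set (by
    rw [uIcc_of_le hF.le, uIcc_of_le hcd]; exact Icc_subset_Icc hac hdb)
  eq_add x hx := by
    rw [← hF.sub_eq ⟨hac, hcd.trans hdb⟩ ⟨hac.trans hx.1, hx.2.trans hdb⟩]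
    ring

lemma congr (hF : IsPrimitiveOn a b F f) (h : EqOn F G (Icc a b)) : IsPrimitiveOn a b G f :=
  ⟨hF.le, hF.intervalIntegrable, fun x hx => by
    rw [← h hx, ← h (left_mem_Icc.2 hF.le), hF.eq_add x hx]⟩

lemma congr_ae (hF : IsPrimitiveOn a b F f) (h : f =ᵐ[volume.restrict (Ioo a b)] g) :
    IsPrimitiveOn a b F g := by
  rw [restrict_Ioo_eq_restrict_Ioc] at h
  refine ⟨hF.le, hF.intervalIntegrable.congr_ae (by rwa [uIoc_of_le hF.le]), fun x hx => ?_⟩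
  rw [hF.eq_add x hx, intervalIntegral.integral_of_le hx.1, intervalIntegral.integral_of_le hx.1,
    integral_congr_ae (ae_restrict_of_ae_restrict_of_subset (Ioc_subset_Ioc_right hx.2) h)]

lemma of_absolutelyContinuousOnInterval (hab : a ≤ b)
    (hF : AbsolutelyContinuousOnInterval F a b) : IsPrimitiveOn a b F (deriv F) where
  le := hab
  intervalIntegrable := hF.intervalIntegrable_deriv
  eq_add x hx := by
    have hx' : uIcc a x ⊆ uIcc a b := uIcc_subset_uIcc_left (by rwa [uIcc_of_le hab])
    rw [(hF.mono hx').integral_deriv_eq_sub]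
    ring

lemma absolutelyContinuousOnInterval_add_integral (hF : IsPrimitiveOn a b F f) :
    AbsolutelyContinuousOnInterval (fun x => F a + ∫ t in a..x, f t) a b :=
  ((LipschitzWith.const (F a)).lipschitzOnWith.absolutelyContinuousOnInterval).fun_add
    (hF.intervalIntegrable.absolutelyContinuousOnInterval_intervalIntegral (c := a) (by simp))

lemma continuousOn (hF : IsPrimitiveOn a b F f) : ContinuousOn F (Icc a b) := by
  have hcont := hF.absolutelyContinuousOnInterval_add_integral.continuousOn
  rw [uIcc_of_le hF.le] at hcont
  exact hcont.congr hF.eq_add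

lemma integral_mul_add_mul (hF : IsPrimitiveOn a b F f) (hG : IsPrimitiveOn a b G g) :
    ∫ x in a..b, (f x * G x + F x * g x) = F b * G b - F a * G a := by
  have hparts := hF.absolutelyContinuousOnInterval_add_integral.integral_deriv_mul_eq_sub
    hG.absolutelyContinuousOnInterval_add_integral
  simp only [intervalIntegral.integral_same, add_zero] at hparts
  rw [← hF.eq_add b (right_mem_Icc.2 hF.le), ← hG.eq_add b (right_mem_Icc.2 hF.le)] at hparts
  rw [← hparts]
  apply intervalIntegral.integral_congr_ae
  filter_upwards [hF.intervalIntegrable.ae_hasDerivAt_integral,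
    hG.intervalIntegrable.ae_hasDerivAt_integral] with x hFx hGx hx
  have hx' := uIoc_subset_uIcc hx
  rw [((hFx hx' a (by simp)).const_add (F a)).deriv, ((hGx hx' a (by simp)).const_add (G a)).deriv]
  rw [uIcc_of_le hF.le] at hx'
  rw [← hF.eq_add x hx', ← hG.eq_add x hx']

lemma const_mul (hF : IsPrimitiveOn a b F f) (k : ℝ) :
    IsPrimitiveOn a b (fun x => k * F x) (fun x => k * f x) where
  le := hF.le
  intervalIntegrable := hF.intervalIntegrable.const_mul k
  eq_add x hx := by
    rw [intervalIntegral.integral_const_mul, hF.eq_add x hx]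
    ring

lemma mul (hF : IsPrimitiveOn a b F f) (hG : IsPrimitiveOn a b G g) :
    IsPrimitiveOn a b (fun x => F x * G x) (fun x => f x * G x + F x * g x) where
  le := hF.le
  intervalIntegrable := by
    refine (hF.intervalIntegrable.mul_continuousOn ?_).add
      (hG.intervalIntegrable.continuousOn_mul ?_)
    · exact uIcc_of_le hF.le ▸ hG.continuousOn
    · exact uIcc_of_le hF.le ▸ hF.continuousOn
  eq_add x hx := by
    rw [(hF.mono le_rfl hx.1 hx.2).integral_mul_add_mul (hG.mono le_rfl hx.1 hx.2)]
    ring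

lemma sub_const (hF : IsPrimitiveOn a b F f) (k : ℝ) : IsPrimitiveOn a b (fun x => F x - k) f :=
  ⟨hF.le, hF.intervalIntegrable, fun x hx => by rw [hF.eq_add x hx]; ring⟩

-- With `S` the step function that jumps at `p`, this is `∫ f G = ∫ S' G - ∫ (F - S) g` up to
-- boundary terms, where `S'` is the Dirac mass at `p`.
lemma integral_mul_eq_of_step {S : ℝ → ℝ} {p : ℝ} (hF : IsPrimitiveOn a b F f)
    (hG : IsPrimitiveOn a b G g) (hp : p ∈ Icc a b) (hS₀ : ∀ x ∈ Ioo a p, S x = 0)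
    (hS₁ : ∀ x ∈ Ioo p b, S x = 1) :
    ∫ x in a..b, f x * G x =
      G p - F a * G a - (1 - F b) * G b - ∫ x in a..b, (F x - S x) * g x := by
  have hleft : IsPrimitiveOn a p (fun x => F x * G x) (fun x => f x * G x + (F x - S x) * g x) :=
    ((hF.mul hG).mono le_rfl hp.1 hp.2).congr_ae <| by
      filter_upwards [ae_restrict_mem measurableSet_Ioo] with x hx
      rw [hS₀ x hx, sub_zero]
  have hright : IsPrimitiveOn p b (fun x => (F x - 1) * G x)
      (fun x => f x * G x + (F x - S x) * g x) :=
    (((hF.sub_const 1).mul hG).mono hp.1 hp.2 le_rfl).congr_ae <| by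
      filter_upwards [ae_restrict_mem measurableSet_Ioo] with x hx
      rw [hS₁ x hx]
  have hfG : IntervalIntegrable (fun x => f x * G x) volume a b :=
    hF.intervalIntegrable.mul_continuousOn (uIcc_of_le hF.le ▸ hG.continuousOn)
  have herr : IntervalIntegrable (fun x => (F x - S x) * g x) volume a b :=
    ((hleft.intervalIntegrable.trans hright.intervalIntegrable).sub hfG).congr_ae
      (ae_of_all _ fun x => add_sub_cancel_left _ _)
  rw [eq_sub_iff_add_eq, ← intervalIntegral.integral_add hfG herr,
    ← intervalIntegral.integral_add_adjacent_intervals hleft.intervalIntegrable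
      hright.intervalIntegrable,
    ← hleft.sub_eq (left_mem_Icc.2 hp.1) (right_mem_Icc.2 hp.1),
    ← hright.sub_eq (left_mem_Icc.2 hp.2) (right_mem_Icc.2 hp.2)]
  ring

lemma abs_integral_mul_sub_le_of_step {S : ℝ → ℝ} {p : ℝ} (hF : IsPrimitiveOn a b F f)
    (hG : IsPrimitiveOn a b G g) (hp : p ∈ Icc a b) (hS₀ : ∀ x ∈ Ioo a p, S x = 0)
    (hS₁ : ∀ x ∈ Ioo p b, S x = 1) (ha : 0 ≤ F a) (hb : F b ≤ 1) :
    |(∫ x in a..b, f x * G x) - G p| ≤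
      F a * |G a| + (1 - F b) * |G b| + ∫ x in a..b, |(F x - S x) * g x| := by
  rw [hF.integral_mul_eq_of_step hG hp hS₀ hS₁]
  have hint := intervalIntegral.abs_integral_le_integral_abs (μ := volume)
    (f := fun x => (F x - S x) * g x) hF.le
  calc _ = |F a * G a + (1 - F b) * G b + ∫ x in a..b, (F x - S x) * g x| := by
        rw [← abs_neg]; ring_nf
    _ ≤ |F a * G a| + |(1 - F b) * G b| + |∫ x in a..b, (F x - S x) * g x| := abs_add_three _ _ _
    _ ≤ _ := by
        rw [abs_mul, abs_mul, abs_of_nonneg ha, abs_of_nonneg (sub_nonneg.2 hb)]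
        gcongr

end IsPrimitiveOn

lemma exists_subset_Icc_of_subset_Ioo {a b : ℝ} {K : Set ℝ} (hK : IsCompact K) (hs : K ⊆ Ioo a b) :
    ∃ c d, a < c ∧ d < b ∧ K ⊆ Icc c d := by
  rcases K.eq_empty_or_nonempty with rfl | hne
  · exact ⟨a + 1, b - 1, by linarith, by linarith, empty_subset _⟩
  · exact ⟨sInf K, sSup K, (hs (hK.sInf_mem hne)).1, (hs (hK.sSup_mem hne)).2,
      hK.isBounded.subset_Icc_sInf_sSup⟩

/-- `ψ` is a test function on `U`, i.e. `ψ ∈ C_c^∞(U)`. -/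
structure IsTestFunction (U : Set ℝ) (ψ : ℝ → ℝ) : Prop where
  contDiff : ContDiff ℝ ∞ ψ
  hasCompactSupport : HasCompactSupport ψ
  tsupport_subset : tsupport ψ ⊆ U

namespace IsTestFunction

variable {U V : Set ℝ} {ψ η z : ℝ → ℝ}

lemma mono (hψ : IsTestFunction U ψ) (hUV : U ⊆ V) : IsTestFunction V ψ :=
  ⟨hψ.contDiff, hψ.hasCompactSupport, hψ.tsupport_subset.trans hUV⟩

lemma eq_zero_of_notMem (hψ : IsTestFunction U ψ) {x : ℝ} (hx : x ∉ U) : ψ x = 0 :=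
  image_eq_zero_of_notMem_tsupport fun h => hx (hψ.tsupport_subset h)

lemma sub (hψ : IsTestFunction U ψ) (hη : IsTestFunction U η) :
    IsTestFunction U (fun x => ψ x - η x) :=
  ⟨hψ.contDiff.sub hη.contDiff, hψ.hasCompactSupport.sub hη.hasCompactSupport,
    (tsupport_sub ψ η).trans (union_subset hψ.tsupport_subset hη.tsupport_subset)⟩

lemma const_mul (hψ : IsTestFunction U ψ) (k : ℝ) : IsTestFunction U (fun x => k * ψ x) :=
  ⟨contDiff_const.mul hψ.contDiff, hψ.hasCompactSupport.mul_left,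
    (tsupport_mul_subset_right).trans hψ.tsupport_subset⟩

lemma deriv (hψ : IsTestFunction U ψ) : IsTestFunction U (deriv ψ) :=
  ⟨(contDiff_infty_iff_deriv.1 hψ.contDiff).2, hψ.hasCompactSupport.deriv,
    tsupport_deriv_subset.trans hψ.tsupport_subset⟩

lemma isPrimitiveOn (hψ : IsTestFunction U ψ) {a b : ℝ} (hab : a ≤ b) :
    IsPrimitiveOn a b ψ (_root_.deriv ψ) :=
  .of_absolutelyContinuousOnInterval hab
    ((hψ.contDiff.of_le (by simp)).contDiffOn.absolutelyContinuousOnInterval)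

lemma integrable (hψ : IsTestFunction U ψ) : Integrable ψ :=
  hψ.contDiff.continuous.integrable_of_hasCompactSupport hψ.hasCompactSupport

lemma integrable_mul (hψ : IsTestFunction U ψ) (hz : LocallyIntegrableOn z U) :
    Integrable (fun x => z x * ψ x) := by
  rw [← integrableOn_iff_integrable_of_support_subset
    ((Function.support_mul_subset_right z ψ).trans (subset_tsupport ψ))]
  exact (hz.integrableOn_compact_subset hψ.tsupport_subset hψ.hasCompactSupport).mul_continuousOn
    hψ.contDiff.continuous.continuousOn hψ.hasCompactSupport

lemma setIntegral_mul (hψ : IsTestFunction U ψ) (z : ℝ → ℝ) :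
    ∫ x in U, z x * ψ x = ∫ x, z x * ψ x :=
  setIntegral_eq_integral_of_forall_compl_eq_zero fun x hx => by
    rw [hψ.eq_zero_of_notMem hx, mul_zero]

lemma intervalIntegral_mul {a b : ℝ} (hab : a ≤ b) (hψ : IsTestFunction (Ioo a b) ψ) (z : ℝ → ℝ) :
    ∫ x in a..b, z x * ψ x = ∫ x, z x * ψ x := by
  rw [intervalIntegral.integral_of_le hab, integral_Ioc_eq_integral_Ioo, hψ.setIntegral_mul]

lemma exists_integral_eq_one {a b : ℝ} (hab : a < b) :
    ∃ ψ, IsTestFunction (Ioo a b) ψ ∧ ∫ x, ψ x = 1 := by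
  let bump : ContDiffBump ((a + b) / 2) := ⟨(b - a) / 8, (b - a) / 4, by linarith, by linarith⟩
  refine ⟨bump.normed volume, ⟨bump.contDiff_normed, bump.hasCompactSupport_normed, ?_⟩,
    bump.integral_normed⟩
  rw [bump.tsupport_normed_eq, Real.closedBall_eq_Icc]
  apply Icc_subset_Ioo <;> simp only [bump] <;> linarith

lemma exists_deriv_eq {a b : ℝ} (hψ : IsTestFunction (Ioo a b) ψ) (h0 : ∫ x, ψ x = 0) :
    ∃ Ψ, IsTestFunction (Ioo a b) Ψ ∧ _root_.deriv Ψ = ψ := by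
  have hcont := hψ.contDiff.continuous
  have hderiv (x : ℝ) : HasDerivAt (fun x => ∫ t in a..x, ψ t) (ψ x) x :=
    intervalIntegral.integral_hasDerivAt_right (hcont.intervalIntegrable _ _)
      hcont.stronglyMeasurable.stronglyMeasurableAtFilter hcont.continuousAt
  have hderiv_eq : _root_.deriv (fun x => ∫ t in a..x, ψ t) = ψ :=
    funext fun x => (hderiv x).deriv
  obtain ⟨c, d, hac, hdb, hsub⟩ :=
    exists_subset_Icc_of_subset_Ioo hψ.hasCompactSupport hψ.tsupport_subset
  have hzero {t : ℝ} (ht : t ∉ Icc c d) : ψ t = 0 :=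
    image_eq_zero_of_notMem_tsupport fun h => ht (hsub h)
  have hsupp : Function.support (fun x => ∫ t in a..x, ψ t) ⊆ Icc c d := by
    refine fun x hx => ⟨not_lt.1 fun hxc => hx ?_, not_lt.1 fun hdx => hx ?_⟩
    · exact intervalIntegral.integral_zero_ae (ae_of_all _ fun t ht =>
        hzero fun h => (h.1.trans ht.2).not_gt (max_lt hac hxc))
    · dsimp only
      rw [intervalIntegral.integral_eq_integral_of_support_subset, h0]
      exact fun t ht => have h := hsub (subset_tsupport ψ ht)
        ⟨hac.trans_le h.1, h.2.trans hdx.le⟩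
  refine ⟨_, ⟨?_, HasCompactSupport.of_support_subset_isCompact isCompact_Icc hsupp,
    (closure_minimal hsupp isClosed_Icc).trans (Icc_subset_Ioo hac hdb)⟩, hderiv_eq⟩
  rw [contDiff_infty_iff_deriv, hderiv_eq]
  exact ⟨fun x => (hderiv x).differentiableAt, hψ.contDiff⟩

end IsTestFunction

lemma ae_eq_const_of_integral_mul_deriv_eq_zero {a b : ℝ} (hab : a < b) {z : ℝ → ℝ}
    (hz : LocallyIntegrableOn z (Ioo a b))
    (h : ∀ ψ, IsTestFunction (Ioo a b) ψ → ∫ x, z x * deriv ψ x = 0) :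
    ∃ C : ℝ, z =ᵐ[volume.restrict (Ioo a b)] fun _ => C := by
  obtain ⟨η, hη, hη1⟩ := IsTestFunction.exists_integral_eq_one hab
  refine ⟨∫ x, z x * η x, ?_⟩
  set C := ∫ x, z x * η x
  have hzC : ∀ᵐ x, x ∈ Ioo a b → z x - C = 0 := by
    refine isOpen_Ioo.ae_eq_zero_of_integral_contDiff_smul_eq_zero
      (hz.sub (locallyIntegrableOn_const C)) fun ψ hψ hψc hψs => ?_
    replace hψ : IsTestFunction (Ioo a b) ψ := ⟨hψ, hψc, hψs⟩
    -- Subtracting a multiple of `η` makes the mean of `ψ` vanish, hence makes `ψ` a derivative.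
    obtain ⟨Ψ, hΨ, hΨd⟩ := (hψ.sub (hη.const_mul (∫ x, ψ x))).exists_deriv_eq (by
      rw [integral_sub hψ.integrable (hη.const_mul _).integrable, integral_const_mul, hη1]; ring)
    have hzΨ := h Ψ hΨ
    simp only [hΨd, mul_sub, mul_left_comm _ (∫ x, ψ x)] at hzΨ
    rw [integral_sub (hψ.integrable_mul hz) ((hη.integrable_mul hz).const_mul _),
      integral_const_mul] at hzΨ
    simp only [smul_eq_mul, mul_sub, mul_comm (ψ _) (z _)]
    rw [integral_sub (hψ.integrable_mul hz) (hψ.integrable.mul_const C), integral_mul_const]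
    exact hzΨ
  rw [EventuallyEq, ae_restrict_iff' measurableSet_Ioo]
  filter_upwards [hzC] with x hx hxm using sub_eq_zero.1 (hx hxm)

namespace HasWeakDeriv

variable {U V : Set ℝ} {w w' z z' : ℝ → ℝ}

lemma integral_mul_deriv (h : HasWeakDeriv U w w') {ψ : ℝ → ℝ} (hψ : IsTestFunction U ψ) :
    ∫ x, w x * deriv ψ x = -∫ x, w' x * ψ x := by
  rw [← hψ.setIntegral_mul, ← hψ.deriv.setIntegral_mul]
  exact h.integral_eq ψ hψ.contDiff hψ.hasCompactSupport hψ.tsupport_subset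

lemma of_integral_mul_deriv (hw : LocallyIntegrableOn w U) (hw' : LocallyIntegrableOn w' U)
    (h : ∀ ψ, IsTestFunction U ψ → ∫ x, w x * deriv ψ x = -∫ x, w' x * ψ x) :
    HasWeakDeriv U w w' where
  locInt := hw
  locInt_deriv := hw'
  integral_eq ψ hψ hψc hψs := by
    have hψ : IsTestFunction U ψ := ⟨hψ, hψc, hψs⟩
    rw [hψ.setIntegral_mul, hψ.deriv.setIntegral_mul, h ψ hψ]

lemma mono (h : HasWeakDeriv V w w') (hUV : U ⊆ V) : HasWeakDeriv U w w' :=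
  of_integral_mul_deriv (h.locInt.mono_set hUV) (h.locInt_deriv.mono_set hUV)
    fun _ hψ => h.integral_mul_deriv (hψ.mono hUV)

lemma sub (hw : HasWeakDeriv U w w') (hz : HasWeakDeriv U z z') :
    HasWeakDeriv U (fun x => w x - z x) (fun x => w' x - z' x) :=
  of_integral_mul_deriv (hw.locInt.sub hz.locInt) (hw.locInt_deriv.sub hz.locInt_deriv)
    fun ψ hψ => by
      simp only [sub_mul]
      rw [integral_sub (hψ.deriv.integrable_mul hw.locInt) (hψ.deriv.integrable_mul hz.locInt),
        integral_sub (hψ.integrable_mul hw.locInt_deriv) (hψ.integrable_mul hz.locInt_deriv),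
        hw.integral_mul_deriv hψ, hz.integral_mul_deriv hψ]
      ring

end HasWeakDeriv

lemma IsPrimitiveOn.hasWeakDeriv {a b : ℝ} {w w' : ℝ → ℝ} (hw : IsPrimitiveOn a b w w') :
    HasWeakDeriv (Ioo a b) w w' := by
  have hw_loc : LocallyIntegrableOn w (Ioo a b) :=
    (hw.continuousOn.mono Ioo_subset_Icc_self).locallyIntegrableOn measurableSet_Ioo
  have hw'_loc : LocallyIntegrableOn w' (Ioo a b) := hw.integrableOn.locallyIntegrableOn
  refine .of_integral_mul_deriv hw_loc hw'_loc fun ψ hψ => ?_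
  have hparts := hw.integral_mul_add_mul (hψ.isPrimitiveOn hw.le)
  rw [hψ.eq_zero_of_notMem (by simp), hψ.eq_zero_of_notMem (by simp),
    intervalIntegral.integral_add, hψ.intervalIntegral_mul hw.le,
    hψ.deriv.intervalIntegral_mul hw.le] at hparts
  · linarith
  · exact (hψ.integrable_mul hw'_loc).intervalIntegrable
  · exact (hψ.deriv.integrable_mul hw_loc).intervalIntegrable

lemma HasWeakDeriv.exists_isPrimitiveOn {a b : ℝ} {w w' : ℝ → ℝ} (hab : a < b)
    (h : HasWeakDeriv (Ioo a b) w w')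
    (hw' : IntegrableOn w' (Ioo a b)) :
    ∃ W, IsPrimitiveOn a b W w' ∧ W =ᵐ[volume.restrict (Ioo a b)] w := by
  have hint : IntervalIntegrable w' volume a b :=
    (intervalIntegrable_iff_integrableOn_Ioo_of_le hab.le).2 hw'
  have hdiff := h.sub (isPrimitiveOn_integral hab.le hint 0).hasWeakDeriv
  obtain ⟨C, hC⟩ := ae_eq_const_of_integral_mul_deriv_eq_zero hab hdiff.locInt fun ψ hψ => by
    rw [hdiff.integral_mul_deriv hψ]
    simp only [sub_self, zero_mul, integral_zero, neg_zero]
  refine ⟨_, isPrimitiveOn_integral hab.le hint C, ?_⟩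
  filter_upwards [hC] with x hx
  linarith

namespace IsContRep

variable {U : Set ℝ} {a b : ℝ} {v w W : ℝ → ℝ}

lemma eqOn_Icc (hw : IsContRep U v w) (hab : a < b) (hsub : Ioo a b ⊆ U)
    (hW : ContinuousOn W (Icc a b)) (hWv : W =ᵐ[volume.restrict (Ioo a b)] v) :
    EqOn W w (Icc a b) := by
  refine Measure.eqOn_Icc_of_ae_eq volume hab.ne ?_ hW
    (hw.1.mono (closure_Ioo hab.ne ▸ closure_mono hsub))
  rw [← restrict_Ioo_eq_restrict_Icc]
  exact hWv.trans (EventuallyEq.symm (ae_restrict_of_ae_restrict_of_subset hsub hw.2))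

lemma isPrimitiveOn {v' : ℝ → ℝ} (hw : IsContRep U v w) (hab : a < b) (hsub : Ioo a b ⊆ U)
    (h : HasWeakDeriv U v v') (hv' : IntegrableOn v' (Ioo a b)) : IsPrimitiveOn a b w v' := by
  obtain ⟨W, hW, hWv⟩ := (h.mono hsub).exists_isPrimitiveOn hab hv'
  exact hW.congr (hw.eqOn_Icc hab hsub hW.continuousOn hWv)

end IsContRep

section L2

variable {X : Type*} {mX : MeasurableSpace X} {μ : Measure X} {f g : X → ℝ}

lemma integral_abs_mul_le (hf : MemLp f 2 μ) (hg : MemLp g 2 μ) :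
    ∫ x, |f x * g x| ∂μ ≤ √(∫ x, f x ^ 2 ∂μ) * √(∫ x, g x ^ 2 ∂μ) := by
  have hf' : MemLp f (ENNReal.ofReal 2) μ := by simpa using hf
  have hg' : MemLp g (ENNReal.ofReal 2) μ := by simpa using hg
  simpa [abs_mul, Real.sqrt_eq_rpow] using
    integral_mul_norm_le_Lp_mul_Lq Real.HolderConjugate.two_two hf' hg'

lemma abs_integral_mul_le (hf : MemLp f 2 μ) (hg : MemLp g 2 μ) :
    |∫ x, f x * g x ∂μ| ≤ √(∫ x, f x ^ 2 ∂μ) * √(∫ x, g x ^ 2 ∂μ) :=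
  (abs_integral_le_integral_abs).trans (integral_abs_mul_le hf hg)

lemma integral_abs_le_sqrt_measureReal_univ_mul [IsFiniteMeasure μ] (hf : MemLp f 2 μ) :
    ∫ x, |f x| ∂μ ≤ √(μ.real univ) * √(∫ x, f x ^ 2 ∂μ) := by
  simpa using integral_abs_mul_le (memLp_const (1 : ℝ)) hf

end L2

section Sobolev

variable {a b : ℝ} {V v : ℝ → ℝ}

lemma IsPrimitiveOn.abs_sub_le (hV : IsPrimitiveOn a b V v) {x y : ℝ} (hx : x ∈ Icc a b)
    (hy : y ∈ Icc a b) : |V y - V x| ≤ ∫ t in Ioo a b, |v t| := by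
  rw [hV.sub_eq hx hy, ← integral_Ioc_eq_integral_Ioo]
  refine (intervalIntegral.norm_integral_le_integral_norm_uIoc (f := v)).trans
    (setIntegral_mono_set ?_ (ae_of_all _ fun t => norm_nonneg _) ?_)
  · exact ((intervalIntegrable_iff_integrableOn_Ioc_of_le hV.le).1 hV.intervalIntegrable).abs
  · exact (Ioc_subset_Ioc (le_min hx.1 hy.1) (max_le hx.2 hy.2)).eventuallyLE

lemma IsPrimitiveOn.abs_le_average_add_integral (hab : a < b) (hV : IsPrimitiveOn a b V v) {x : ℝ}
    (hx : x ∈ Icc a b) : |V x| ≤ (⨍ y in Ioo a b, |V y|) + ∫ y in Ioo a b, |v y| := by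
  obtain ⟨y, hy, hVy⟩ : ∃ y ∈ Ioo a b, |V y| ≤ ⨍ y in Ioo a b, |V y| :=
    exists_le_setAverage (by simpa using hab) measure_Ioo_lt_top.ne
      (hV.continuousOn.abs.integrableOn_Icc.mono_set Ioo_subset_Icc_self)
  linarith [abs_sub_abs_le_abs_sub (V x) (V y), hV.abs_sub_le (Ioo_subset_Icc_self hy) hx]

lemma IsPrimitiveOn.abs_le (hab : a < b) (hV : IsPrimitiveOn a b V v)
    (hV2 : MemLp V 2 (volume.restrict (Ioo a b))) (hv2 : MemLp v 2 (volume.restrict (Ioo a b)))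
    {x : ℝ} (hx : x ∈ Icc a b) :
    |V x| ≤ (√(b - a))⁻¹ * √(∫ y in Ioo a b, V y ^ 2) +
      √(b - a) * √(∫ y in Ioo a b, v y ^ 2) := by
  have : 0 < b - a := sub_pos.2 hab
  have hvol : (volume.restrict (Ioo a b)).real univ = b - a := by simp [hab.le]
  have hV1 := integral_abs_le_sqrt_measureReal_univ_mul hV2
  have hv1 := integral_abs_le_sqrt_measureReal_univ_mul hv2
  rw [hvol] at hV1 hv1
  calc |V x| ≤ (b - a)⁻¹ * (∫ y in Ioo a b, |V y|) + ∫ y in Ioo a b, |v y| := by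
        simpa [average_eq, hab.le] using hV.abs_le_average_add_integral hab hx
    _ ≤ (b - a)⁻¹ * (√(b - a) * √(∫ y in Ioo a b, V y ^ 2)) +
          √(b - a) * √(∫ y in Ioo a b, v y ^ 2) := by gcongr
    _ = _ := by
        rw [← mul_assoc, inv_mul_eq_div, Real.sqrt_div_self]

end Sobolev

namespace H1

variable {U : Set ℝ}

instance : Sub (H1 U) where
  sub u v :=
    { toFun x := u x - v x
      grad x := u.grad x - v.grad x
      memLp := u.memLp.sub v.memLp
      memLp_grad := u.memLp_grad.sub v.memLp_grad
      hasWeakDeriv := u.hasWeakDeriv.sub v.hasWeakDeriv }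

@[simp] lemma sub_apply (u v : H1 U) (x : ℝ) : (u - v) x = u x - v x := rfl

@[simp] lemma grad_sub (u v : H1 U) (x : ℝ) : (u - v).grad x = u.grad x - v.grad x := rfl

/-- The norm of `H¹(U)`; it satisfies `(u - v).norm = u.dist v` definitionally. -/
noncomputable def norm (v : H1 U) : ℝ := √((∫ x in U, v x ^ 2) + ∫ x in U, v.grad x ^ 2)

lemma sq_norm (v : H1 U) : v.norm ^ 2 = (∫ x in U, v x ^ 2) + ∫ x in U, v.grad x ^ 2 :=
  Real.sq_sqrt (add_nonneg (integral_nonneg fun _ => sq_nonneg _)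
    (integral_nonneg fun _ => sq_nonneg _))

lemma norm_nonneg (v : H1 U) : 0 ≤ v.norm := Real.sqrt_nonneg _

lemma sqrt_integral_sq_le_norm (v : H1 U) : √(∫ x in U, v x ^ 2) ≤ v.norm :=
  Real.sqrt_le_sqrt (le_add_of_nonneg_right (integral_nonneg fun _ => sq_nonneg _))

lemma sqrt_integral_grad_sq_le_norm (v : H1 U) : √(∫ x in U, v.grad x ^ 2) ≤ v.norm :=
  Real.sqrt_le_sqrt (le_add_of_nonneg_left (integral_nonneg fun _ => sq_nonneg _))

/-- The representative of `v ∈ H¹(a, b)` that is absolutely continuous on `[a, b]`. -/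
noncomputable def contRep {a b : ℝ} (v : H1 (Ioo a b)) : ℝ → ℝ :=
  Classical.epsilon fun V => IsPrimitiveOn a b V v.grad ∧ V =ᵐ[volume.restrict (Ioo a b)] v

variable {a b : ℝ} (hab : a < b) (v : H1 (Ioo a b))

include hab

lemma contRep_spec : IsPrimitiveOn a b v.contRep v.grad ∧
    v.contRep =ᵐ[volume.restrict (Ioo a b)] v :=
  Classical.epsilon_spec
    (v.hasWeakDeriv.exists_isPrimitiveOn hab (v.memLp_grad.integrable one_le_two))

lemma isPrimitiveOn_contRep : IsPrimitiveOn a b v.contRep v.grad := (v.contRep_spec hab).1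

lemma contRep_ae_eq : v.contRep =ᵐ[volume.restrict (Ioo a b)] v := (v.contRep_spec hab).2

variable {v} in
lemma contRep_eqOn {w : ℝ → ℝ} (hw : IsContRep (Ioo a b) v w) : EqOn v.contRep w (Icc a b) :=
  hw.eqOn_Icc hab Subset.rfl (v.isPrimitiveOn_contRep hab).continuousOn (v.contRep_ae_eq hab)

lemma abs_contRep_le {x : ℝ} (hx : x ∈ Icc a b) :
    |v.contRep x| ≤ ((√(b - a))⁻¹ + √(b - a)) * v.norm := by
  have hsq : ∫ y in Ioo a b, v.contRep y ^ 2 = ∫ y in Ioo a b, v y ^ 2 :=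
    integral_congr_ae ((v.contRep_ae_eq hab).mono fun y hy => by simp only [hy])
  have hle := (v.isPrimitiveOn_contRep hab).abs_le hab
    (v.memLp.ae_eq (v.contRep_ae_eq hab).symm) v.memLp_grad hx
  rw [hsq] at hle
  rw [add_mul]
  exact hle.trans (by gcongr; exacts [v.sqrt_integral_sq_le_norm, v.sqrt_integral_grad_sq_le_norm])

end H1

/-- The functionals `T i` on `H¹(U)` tend to zero along `l` in the dual norm. They are not required
to be linear. -/
def TendstoZeroInDual {U : Set ℝ} {ι : Type*} (T : ι → H1 U → ℝ) (l : Filter ι) : Prop :=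
  ∃ δ : ι → ℝ, Tendsto δ l (𝓝 0) ∧ ∀ᶠ i in l, ∀ v, |T i v| ≤ δ i * v.norm

namespace TendstoZeroInDual

variable {U : Set ℝ} {ι : Type*} {T S : ι → H1 U → ℝ} {l : Filter ι}

lemma add (hT : TendstoZeroInDual T l) (hS : TendstoZeroInDual S l) :
    TendstoZeroInDual (fun i v => T i v + S i v) l := by
  obtain ⟨δ, hδ, hTδ⟩ := hT
  obtain ⟨η, hη, hSη⟩ := hS
  refine ⟨fun i => δ i + η i, by simpa using hδ.add hη, ?_⟩
  filter_upwards [hTδ, hSη] with i hTi hSi v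
  exact (abs_add_le _ _).trans (add_mul (δ i) _ _ ▸ add_le_add (hTi v) (hSi v))

lemma const_mul (hT : TendstoZeroInDual T l) (k : ℝ) :
    TendstoZeroInDual (fun i v => k * T i v) l := by
  obtain ⟨δ, hδ, hTδ⟩ := hT
  refine ⟨fun i => |k| * δ i, by simpa using hδ.const_mul |k|, ?_⟩
  filter_upwards [hTδ] with i hTi v
  rw [abs_mul, mul_assoc]
  exact mul_le_mul_of_nonneg_left (hTi v) (abs_nonneg k)

end TendstoZeroInDual

lemma lipschitzWith_sigmoid : LipschitzWith 1 Real.sigmoid := by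
  refine lipschitzWith_of_nnnorm_deriv_le differentiable_sigmoid fun t => ?_
  have h₀ := Real.sigmoid_nonneg t
  have h₁ := Real.sigmoid_le_one t
  rw [← NNReal.coe_le_coe, coe_nnnorm, Real.deriv_sigmoid, NNReal.coe_one,
    Real.norm_of_nonneg (mul_nonneg h₀ (sub_nonneg.2 h₁))]
  exact mul_le_one₀ h₁ (sub_nonneg.2 h₁) (sub_le_self 1 h₀)

lemma ae_ne (c : ℝ) (U : Set ℝ) : ∀ᵐ x ∂volume.restrict U, x ≠ c :=
  ae_restrict_of_ae (by simp [ae_iff])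

namespace Data

variable (P : Data)

/-- The midpoint of `Ω₁`, where `r` and `φ ε` attain their maximum. -/
noncomputable def mid : ℝ := (P.a₁ + P.b₁) / 2

lemma a₁_lt_mid : P.a₁ < P.mid := left_lt_add_div_two.2 P.a₁_lt

lemma mid_lt_b₁ : P.mid < P.b₁ := add_div_two_lt_right.2 P.a₁_lt

lemma a_lt_mid : P.a < P.mid := P.a_lt.trans P.a₁_lt_mid

lemma mid_lt_b : P.mid < P.b := P.mid_lt_b₁.trans P.b₁_lt

lemma a_lt_b : P.a < P.b := P.a_lt_mid.trans P.mid_lt_b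

section SignedDistance

lemma infDist_frontier_Ω₁ (x : ℝ) :
    Metric.infDist x (frontier P.Ω₁) = min |x - P.a₁| |x - P.b₁| := by
  have hrange : range (fun y : ({P.a₁, P.b₁} : Set ℝ) => dist x y) =
      {|x - P.a₁|, |x - P.b₁|} := by
    ext t
    simp [Real.dist_eq]
  rw [Ω₁, frontier_Ioo P.a₁_lt, Metric.infDist_eq_iInf, ← sInf_range, hrange, csInf_pair]

lemma r_eq_min (x : ℝ) : P.r x = min (x - P.a₁) (P.b₁ - x) := by
  have hlt := P.a₁_lt
  rw [r, infDist_frontier_Ω₁]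
  simp only [Ω₁, mem_Ioo]
  grind

lemma lipschitzWith_r : LipschitzWith 1 P.r := by
  rw [funext P.r_eq_min]
  have hmin := (LipschitzWith.id.sub (LipschitzWith.const P.a₁)).min
    ((LipschitzWith.const P.b₁).sub (LipschitzWith.id (α := ℝ)))
  simpa using hmin

lemma monotoneOn_r : MonotoneOn P.r (Iic P.mid) := by
  intro x hx y hy hxy
  simp only [mid, mem_Iic] at hx hy
  grind [r_eq_min]

lemma antitoneOn_r : AntitoneOn P.r (Ici P.mid) := by
  intro x hx y hy hxy
  simp only [mid, mem_Ici] at hx hy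
  grind [r_eq_min]

lemma r_pos {x : ℝ} (hx : x ∈ P.Ω₁) : 0 < P.r x := by
  rw [r_eq_min]
  exact lt_min (sub_pos.2 hx.1) (sub_pos.2 hx.2)

lemma r_neg {x : ℝ} (hx : x ∉ P.Ω₁) (ha : x ≠ P.a₁) (hb : x ≠ P.b₁) : P.r x < 0 := by
  simp only [Ω₁, mem_Ioo] at hx
  grind [r_eq_min]

end SignedDistance

section PhaseField

variable (ε : ℝ)

lemma φ_eq_sigmoid (x : ℝ) : P.φ ε x = Real.sigmoid (2 / ε * P.r x) := by
  rw [show 2 / ε * P.r x = 2 * (P.r x / ε) by ring, φ, Real.tanh_eq, Real.sigmoid_def]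
  generalize P.r x / ε = t
  rw [show -(2 * t) = -t + -t by ring, Real.exp_add, Real.exp_neg]
  field_simp
  ring

lemma φ_nonneg (x : ℝ) : 0 ≤ P.φ ε x := P.φ_eq_sigmoid ε x ▸ Real.sigmoid_nonneg _

lemma φ_le_one (x : ℝ) : P.φ ε x ≤ 1 := P.φ_eq_sigmoid ε x ▸ Real.sigmoid_le_one _

lemma exists_lipschitzWith_φ : ∃ C, LipschitzWith C (P.φ ε) := by
  rw [funext (P.φ_eq_sigmoid ε)]
  exact ⟨_, lipschitzWith_sigmoid.comp ((lipschitzWith_smul (2 / ε)).comp P.lipschitzWith_r)⟩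

lemma continuous_φ : Continuous (P.φ ε) := (P.exists_lipschitzWith_φ ε).choose_spec.continuous

lemma isPrimitiveOn_φ {s t : ℝ} (hst : s ≤ t) : IsPrimitiveOn s t (P.φ ε) (deriv (P.φ ε)) :=
  .of_absolutelyContinuousOnInterval hst
    (P.exists_lipschitzWith_φ ε).choose_spec.lipschitzOnWith.absolutelyContinuousOnInterval

variable {ε}

lemma deriv_φ_nonneg (hε : 0 < ε) {x : ℝ} (hx : x < P.mid) : 0 ≤ deriv (P.φ ε) x := by
  rw [← derivWithin_of_mem_nhds (Iic_mem_nhds hx)]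
  refine MonotoneOn.derivWithin_nonneg fun y hy z hz hyz => ?_
  rw [φ_eq_sigmoid, φ_eq_sigmoid]
  exact Real.sigmoid_le (by gcongr; exact P.monotoneOn_r hy hz hyz)

lemma deriv_φ_nonpos (hε : 0 < ε) {x : ℝ} (hx : P.mid < x) : deriv (P.φ ε) x ≤ 0 := by
  rw [← derivWithin_of_mem_nhds (Ici_mem_nhds hx)]
  refine AntitoneOn.derivWithin_nonpos fun y hy z hz hyz => ?_
  rw [φ_eq_sigmoid, φ_eq_sigmoid]
  exact Real.sigmoid_le (by gcongr; exact P.antitoneOn_r hy hz hyz)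

lemma isPrimitiveOn_φ_left (hε : 0 < ε) :
    IsPrimitiveOn P.a P.mid (P.φ ε) (fun x => |deriv (P.φ ε) x|) := by
  refine (P.isPrimitiveOn_φ ε P.a_lt_mid.le).congr_ae ?_
  filter_upwards [ae_restrict_mem measurableSet_Ioo] with x hx
  rw [abs_of_nonneg (P.deriv_φ_nonneg hε hx.2)]

lemma isPrimitiveOn_one_sub_φ_right (hε : 0 < ε) :
    IsPrimitiveOn P.mid P.b (fun x => 1 - P.φ ε x) (fun x => |deriv (P.φ ε) x|) := by
  have hprim := ((P.isPrimitiveOn_φ ε P.mid_lt_b.le).sub_const 1).const_mul (-1)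
  refine (hprim.congr fun x _ => by ring).congr_ae ?_
  filter_upwards [ae_restrict_mem measurableSet_Ioo] with x hx
  rw [abs_of_nonpos (P.deriv_φ_nonpos hε hx.1), neg_one_mul]

variable {μ : Measure ℝ}

lemma memLp_top_φ : MemLp (P.φ ε) ⊤ μ :=
  memLp_top_of_bound (P.continuous_φ ε).aestronglyMeasurable 1 (ae_of_all _ fun x => by
    rw [Real.norm_of_nonneg (P.φ_nonneg ε x)]; exact P.φ_le_one ε x)

lemma memLp_top_abs_deriv_φ : MemLp (fun x => |deriv (P.φ ε) x|) ⊤ μ := by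
  obtain ⟨C, hC⟩ := P.exists_lipschitzWith_φ ε
  exact memLp_top_of_bound (measurable_deriv _).abs.aestronglyMeasurable C
    (ae_of_all _ fun x => by simpa using norm_deriv_le_of_lipschitz hC)

end PhaseField

section SharpLimit

/-- The indicator function of `Ω₁`, the sharp-interface limit of the phase field. -/
noncomputable def χ : ℝ → ℝ := P.Ω₁.indicator 1

variable {P} in
lemma χ_of_mem {x : ℝ} (hx : x ∈ P.Ω₁) : P.χ x = 1 := indicator_of_mem hx _

variable {P} in
lemma χ_of_notMem {x : ℝ} (hx : x ∉ P.Ω₁) : P.χ x = 0 := indicator_of_notMem hx _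

lemma χ_mem_Icc (x : ℝ) : P.χ x ∈ Icc (0 : ℝ) 1 :=
  ⟨indicator_nonneg (fun _ _ => zero_le_one) x, indicator_le_self' (fun _ _ => zero_le_one) x⟩

lemma memLp_top_χ {μ : Measure ℝ} : MemLp P.χ ⊤ μ :=
  memLp_top_of_bound (measurable_one.indicator measurableSet_Ioo).aestronglyMeasurable 1
    (ae_of_all _ fun x => by
      rw [Real.norm_of_nonneg (P.χ_mem_Icc x).1]; exact (P.χ_mem_Icc x).2)

lemma abs_φ_sub_χ_le_one (ε x : ℝ) : |P.φ ε x - P.χ x| ≤ 1 :=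
  abs_sub_le_of_nonneg_of_le (P.φ_nonneg ε x) (P.φ_le_one ε x) (P.χ_mem_Icc x).1 (P.χ_mem_Icc x).2

lemma tendsto_φ {x : ℝ} (ha : x ≠ P.a₁) (hb : x ≠ P.b₁) :
    Tendsto (fun ε => P.φ ε x) (𝓝[>] 0) (𝓝 (P.χ x)) := by
  have hscale : Tendsto (fun ε : ℝ => 2 / ε) (𝓝[>] 0) atTop :=
    tendsto_inv_nhdsGT_zero.const_mul_atTop two_pos
  simp only [φ_eq_sigmoid]
  by_cases hx : x ∈ P.Ω₁
  · rw [χ_of_mem hx]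
    exact Real.tendsto_sigmoid_atTop.comp (hscale.atTop_mul_const (P.r_pos hx))
  · rw [χ_of_notMem hx]
    exact Real.tendsto_sigmoid_atBot.comp (hscale.atTop_mul_const_of_neg (P.r_neg hx ha hb))

/-- The error, in `L²(Ω)`, of replacing `χ` by `φ ε` as a weight of `A`. -/
noncomputable def phaseError (ε : ℝ) (A : ℝ → ℝ) : ℝ :=
  √(∫ x in P.Ω, ((P.φ ε x - P.χ x) * A x) ^ 2)

variable {P} {A : ℝ → ℝ} (hA : MemLp A 2 (volume.restrict P.Ω))

include hA

lemma memLp_φ_sub_χ_mul (ε : ℝ) :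
    MemLp (fun x => (P.φ ε x - P.χ x) * A x) 2 (volume.restrict P.Ω) :=
  hA.mul' (P.memLp_top_φ.sub P.memLp_top_χ)

lemma tendsto_phaseError : Tendsto (fun ε => P.phaseError ε A) (𝓝[>] 0) (𝓝 0) := by
  suffices hlim : Tendsto (fun ε => ∫ x in P.Ω, ((P.φ ε x - P.χ x) * A x) ^ 2) (𝓝[>] 0)
      (𝓝 (∫ _ in P.Ω, 0)) by
    simpa [phaseError] using hlim.sqrt
  refine tendsto_integral_filter_of_dominated_convergence (fun x => A x ^ 2)
    (.of_forall fun ε => (memLp_φ_sub_χ_mul hA ε).integrable_sq.aestronglyMeasurable)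
    (.of_forall fun ε => ae_of_all _ fun x => ?_) hA.integrable_sq ?_
  · rw [Real.norm_of_nonneg (sq_nonneg _), mul_pow]
    exact mul_le_of_le_one_left (sq_nonneg _)
      ((sq_le_one_iff_abs_le_one _).2 (P.abs_φ_sub_χ_le_one ε x))
  · filter_upwards [ae_ne P.a₁ P.Ω, ae_ne P.b₁ P.Ω] with x ha hb
    simpa using (((P.tendsto_φ ha hb).sub_const (P.χ x)).mul_const (A x)).pow 2

lemma integral_abs_φ_sub_χ_mul_le (ε : ℝ) {B : ℝ → ℝ} (hB : MemLp B 2 (volume.restrict P.Ω)) :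
    ∫ x in P.Ω, |(P.φ ε x - P.χ x) * A x * B x| ≤ P.phaseError ε A * √(∫ x in P.Ω, B x ^ 2) :=
  integral_abs_mul_le (memLp_φ_sub_χ_mul hA ε) hB

end SharpLimit

end Data

lemma setIntegral_Ioo_eq_add {s c t : ℝ} {F : ℝ → ℝ} (hsc : s ≤ c) (hct : c ≤ t)
    (hF : IntegrableOn F (Ioo s t)) :
    ∫ x in Ioo s t, F x = (∫ x in Ioo s c, F x) + ∫ x in Ioo c t, F x := by
  simp only [← integral_Ioc_eq_integral_Ioo, ← intervalIntegral.integral_of_le, hsc, hct,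
    hsc.trans hct]
  rw [← intervalIntegrable_iff_integrableOn_Ioo_of_le (hsc.trans hct)] at hF
  exact (intervalIntegral.integral_add_adjacent_intervals
    (hF.mono_set (uIcc_subset_uIcc_left (by simp [hsc, hct, uIcc_of_le (hsc.trans hct)])))
    (hF.mono_set (uIcc_subset_uIcc_right (by simp [hsc, hct, uIcc_of_le (hsc.trans hct)])))).symm

namespace Data

variable {P : Data}

variable (P) in
/-- The interface functional `∑_{∂Ω₁} w v` of the sharp problem. -/
noncomputable def trace (w v : H1 P.Ω) : ℝ :=
  w.contRep P.a₁ * v.contRep P.a₁ + w.contRep P.b₁ * v.contRep P.b₁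

variable (P) in
/-- The regularised interface functional, with the Dirac masses on `∂Ω₁` replaced by `|φ_ε'|`. -/
noncomputable def diffuseTrace (ε : ℝ) (w v : H1 P.Ω) : ℝ :=
  ∫ x in P.Ω, |deriv (P.φ ε) x| * w x * v x

lemma integrable_abs_deriv_φ_mul (ε : ℝ) (w v : H1 P.Ω) :
    Integrable (fun x => |deriv (P.φ ε) x| * w x * v x) (volume.restrict P.Ω) :=
  (w.memLp.mul' (r := 2) P.memLp_top_abs_deriv_φ).integrable_mul v.memLp

variable {ε : ℝ}

/-- The derivative of the product of two elements of `H¹(Ω)`, as given by the Leibniz rule. -/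
noncomputable def gradMul (w v : H1 P.Ω) (x : ℝ) : ℝ := w.grad x * v x + w x * v.grad x

lemma isPrimitiveOn_contRep_mul (w v : H1 P.Ω) :
    IsPrimitiveOn P.a P.b (fun x => w.contRep x * v.contRep x) (gradMul w v) := by
  refine ((w.isPrimitiveOn_contRep P.a_lt_b).mul (v.isPrimitiveOn_contRep P.a_lt_b)).congr_ae ?_
  filter_upwards [w.contRep_ae_eq P.a_lt_b, v.contRep_ae_eq P.a_lt_b] with x hw hv
  rw [gradMul, hw, hv]

lemma integrable_abs_φ_sub_χ_mul_gradMul (w v : H1 P.Ω) :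
    Integrable (fun x => |(P.φ ε x - P.χ x) * gradMul w v x|) (volume.restrict P.Ω) := by
  refine (((memLp_φ_sub_χ_mul w.memLp_grad ε).integrable_mul v.memLp).add
    ((memLp_φ_sub_χ_mul w.memLp ε).integrable_mul v.memLp_grad)).abs.congr (ae_of_all _ fun x => ?_)
  simp only [gradMul, Pi.add_apply, Pi.mul_apply, mul_add, mul_assoc]

lemma integral_abs_φ_sub_χ_mul_gradMul_le (ε : ℝ) (w v : H1 P.Ω) :
    ∫ x in P.Ω, |(P.φ ε x - P.χ x) * gradMul w v x| ≤
      (P.phaseError ε w.grad + P.phaseError ε w) * v.norm := by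
  have hgrad := ((memLp_φ_sub_χ_mul w.memLp_grad ε).integrable_mul v.memLp).abs
  have hval := ((memLp_φ_sub_χ_mul w.memLp ε).integrable_mul v.memLp_grad).abs
  calc ∫ x in P.Ω, |(P.φ ε x - P.χ x) * gradMul w v x|
      ≤ ∫ x in P.Ω, (|(P.φ ε x - P.χ x) * w.grad x * v x| +
          |(P.φ ε x - P.χ x) * w x * v.grad x|) := by
        refine integral_mono (integrable_abs_φ_sub_χ_mul_gradMul w v) (hgrad.add hval) fun x => ?_
        simpa only [gradMul, mul_add, mul_assoc] using abs_add_le _ _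
    _ = (∫ x in P.Ω, |(P.φ ε x - P.χ x) * w.grad x * v x|) +
          ∫ x in P.Ω, |(P.φ ε x - P.χ x) * w x * v.grad x| := integral_add hgrad hval
    _ ≤ P.phaseError ε w.grad * v.norm + P.phaseError ε w * v.norm :=
        add_le_add
          ((integral_abs_φ_sub_χ_mul_le w.memLp_grad ε v.memLp).trans
            (mul_le_mul_of_nonneg_left v.sqrt_integral_sq_le_norm (Real.sqrt_nonneg _)))
          ((integral_abs_φ_sub_χ_mul_le w.memLp ε v.memLp_grad).trans
            (mul_le_mul_of_nonneg_left v.sqrt_integral_grad_sq_le_norm (Real.sqrt_nonneg _)))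
    _ = _ := (add_mul _ _ _).symm

lemma diffuseTrace_eq_add (w v : H1 P.Ω) : P.diffuseTrace ε w v =
    (∫ x in P.a..P.mid, |deriv (P.φ ε) x| * (w.contRep x * v.contRep x)) +
      ∫ x in P.mid..P.b, |deriv (P.φ ε) x| * (w.contRep x * v.contRep x) := by
  have hae : (fun x => |deriv (P.φ ε) x| * w x * v x) =ᵐ[volume.restrict P.Ω]
      fun x => |deriv (P.φ ε) x| * (w.contRep x * v.contRep x) := by
    filter_upwards [w.contRep_ae_eq P.a_lt_b, v.contRep_ae_eq P.a_lt_b] with x hw hv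
    rw [hw, hv, mul_assoc]
  rw [diffuseTrace, integral_congr_ae hae,
    intervalIntegral.integral_of_le P.a_lt_mid.le, intervalIntegral.integral_of_le P.mid_lt_b.le,
    integral_Ioc_eq_integral_Ioo, integral_Ioc_eq_integral_Ioo]
  exact setIntegral_Ioo_eq_add P.a_lt_mid.le P.mid_lt_b.le
    ((integrable_abs_deriv_φ_mul ε w v).congr hae)

lemma abs_integral_abs_deriv_φ_left_sub_le (hε : 0 < ε) (w v : H1 P.Ω) :
    |(∫ x in P.a..P.mid, |deriv (P.φ ε) x| * (w.contRep x * v.contRep x)) -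
        w.contRep P.a₁ * v.contRep P.a₁| ≤
      P.φ ε P.a * |w.contRep P.a * v.contRep P.a| +
        (1 - P.φ ε P.mid) * |w.contRep P.mid * v.contRep P.mid| +
        ∫ x in Ioo P.a P.mid, |(P.φ ε x - P.χ x) * gradMul w v x| := by
  rw [← integral_Ioc_eq_integral_Ioo, ← intervalIntegral.integral_of_le P.a_lt_mid.le]
  refine (P.isPrimitiveOn_φ_left hε).abs_integral_mul_sub_le_of_step
    ((isPrimitiveOn_contRep_mul w v).mono le_rfl P.a_lt_mid.le P.mid_lt_b.le)
    ⟨P.a_lt.le, P.a₁_lt_mid.le⟩ (fun x hx => χ_of_notMem fun h => h.1.not_gt hx.2)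
    (fun x hx => χ_of_mem ⟨hx.1, hx.2.trans P.mid_lt_b₁⟩) (P.φ_nonneg ε _) (P.φ_le_one ε _)

lemma abs_integral_abs_deriv_φ_right_sub_le (hε : 0 < ε) (w v : H1 P.Ω) :
    |(∫ x in P.mid..P.b, |deriv (P.φ ε) x| * (w.contRep x * v.contRep x)) -
        w.contRep P.b₁ * v.contRep P.b₁| ≤
      (1 - P.φ ε P.mid) * |w.contRep P.mid * v.contRep P.mid| +
        P.φ ε P.b * |w.contRep P.b * v.contRep P.b| +
        ∫ x in Ioo P.mid P.b, |(P.φ ε x - P.χ x) * gradMul w v x| := by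
  rw [← integral_Ioc_eq_integral_Ioo, ← intervalIntegral.integral_of_le P.mid_lt_b.le]
  have hstep := (P.isPrimitiveOn_one_sub_φ_right hε).abs_integral_mul_sub_le_of_step
    (S := fun x => 1 - P.χ x)
    ((isPrimitiveOn_contRep_mul w v).mono P.a_lt_mid.le P.mid_lt_b.le le_rfl)
    ⟨P.mid_lt_b₁.le, P.b₁_lt.le⟩
    (fun x hx => by rw [χ_of_mem ⟨P.a₁_lt_mid.trans hx.1, hx.2⟩, sub_self])
    (fun x hx => by rw [χ_of_notMem fun h => h.2.not_gt hx.1, sub_zero])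
    (sub_nonneg.2 (P.φ_le_one ε _)) (sub_le_self 1 (P.φ_nonneg ε _))
  simpa only [sub_sub_cancel, sub_sub_sub_cancel_left, abs_mul, abs_sub_comm (P.χ _)] using hstep

variable (P) in
/-- The deviation of `φ ε` from `χ` at the end points of `[a, mid]` and of `[mid, b]`. -/
noncomputable def endpointError (ε : ℝ) : ℝ :=
  P.φ ε P.a + 2 * (1 - P.φ ε P.mid) + P.φ ε P.b

variable (P) in
lemma tendsto_endpointError : Tendsto P.endpointError (𝓝[>] 0) (𝓝 0) := by
  have ha := P.tendsto_φ P.a_lt.ne (P.a_lt.trans P.a₁_lt).ne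
  have hmid := P.tendsto_φ P.a₁_lt_mid.ne' P.mid_lt_b₁.ne
  have hb := P.tendsto_φ (P.a₁_lt.trans P.b₁_lt).ne' P.b₁_lt.ne'
  rw [χ_of_notMem fun h => lt_asymm h.1 P.a_lt] at ha
  rw [χ_of_mem ⟨P.a₁_lt_mid, P.mid_lt_b₁⟩] at hmid
  rw [χ_of_notMem fun h => lt_asymm h.2 P.b₁_lt] at hb
  have hsum : Tendsto P.endpointError (𝓝[>] 0) (𝓝 (0 + 2 * (1 - 1) + 0)) :=
    (ha.add ((hmid.const_sub 1).const_mul 2)).add hb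
  simpa using hsum

variable (P) in
/-- A constant of the Sobolev embedding of `H¹(Ω)` into `C(Ω)`. -/
noncomputable def sobolevConst : ℝ := (√(P.b - P.a))⁻¹ + √(P.b - P.a)

lemma abs_contRep_mul_contRep_le (w v : H1 P.Ω) {x : ℝ} (hx : x ∈ Icc P.a P.b) :
    |w.contRep x * v.contRep x| ≤ P.sobolevConst ^ 2 * w.norm * v.norm := by
  have hw : |w.contRep x| ≤ P.sobolevConst * w.norm := w.abs_contRep_le P.a_lt_b hx
  have hv : |v.contRep x| ≤ P.sobolevConst * v.norm := v.abs_contRep_le P.a_lt_b hx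
  calc |w.contRep x * v.contRep x| = |w.contRep x| * |v.contRep x| := abs_mul _ _
    _ ≤ _ * _ := mul_le_mul hw hv (abs_nonneg _) ((abs_nonneg _).trans hw)
    _ = _ := by ring

lemma abs_diffuseTrace_sub_trace_le (hε : 0 < ε) (w v : H1 P.Ω) :
    |P.diffuseTrace ε w v - P.trace w v| ≤
      (P.endpointError ε * (P.sobolevConst ^ 2 * w.norm) +
        (P.phaseError ε w.grad + P.phaseError ε w)) * v.norm := by
  have hsplit : (∫ x in P.Ω, |(P.φ ε x - P.χ x) * gradMul w v x|) =
      (∫ x in Ioo P.a P.mid, |(P.φ ε x - P.χ x) * gradMul w v x|) +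
        ∫ x in Ioo P.mid P.b, |(P.φ ε x - P.χ x) * gradMul w v x| :=
    setIntegral_Ioo_eq_add P.a_lt_mid.le P.mid_lt_b.le (integrable_abs_φ_sub_χ_mul_gradMul w v)
  have hleft := abs_integral_abs_deriv_φ_left_sub_le hε w v
  have hright := abs_integral_abs_deriv_φ_right_sub_le hε w v
  have hphase := integral_abs_φ_sub_χ_mul_gradMul_le ε w v
  have ha := mul_le_mul_of_nonneg_left
    (abs_contRep_mul_contRep_le w v (left_mem_Icc.2 P.a_lt_b.le)) (P.φ_nonneg ε P.a)
  have hmid := mul_le_mul_of_nonneg_left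
    (abs_contRep_mul_contRep_le w v ⟨P.a_lt_mid.le, P.mid_lt_b.le⟩)
    (sub_nonneg.2 (P.φ_le_one ε P.mid))
  have hb := mul_le_mul_of_nonneg_left
    (abs_contRep_mul_contRep_le w v (right_mem_Icc.2 P.a_lt_b.le)) (P.φ_nonneg ε P.b)
  rw [diffuseTrace_eq_add, trace, add_sub_add_comm]
  refine (abs_add_le _ _).trans ((add_le_add hleft hright).trans ?_)
  simp only [endpointError]
  linarith

lemma tendstoZeroInDual_diffuseTrace_sub_trace (w : H1 P.Ω) :
    TendstoZeroInDual (fun ε v => P.diffuseTrace ε w v - P.trace w v) (𝓝[>] 0) := by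
  refine ⟨_, ?_, eventually_mem_nhdsWithin.mono fun ε hε v => abs_diffuseTrace_sub_trace_le hε w v⟩
  simpa using (P.tendsto_endpointError.mul_const _).add
    ((tendsto_phaseError w.memLp_grad).add (tendsto_phaseError w.memLp))

end Data

lemma IsContRep.setIntegral_flux_eq {U : Set ℝ} {s t k : ℝ} {u' z p F V v : ℝ → ℝ} (hst : s < t)
    (hsub : Ioo s t ⊆ U) (hp : IsContRep U u' p) (hz : HasWeakDeriv U u' z)
    (hk : k ≠ 0) (hF : IntegrableOn F (Ioo s t))
    (heq : ∀ᵐ x ∂volume.restrict (Ioo s t), k * z x = F x) (hV : IsPrimitiveOn s t V v) :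
    ∫ x in Ioo s t, (k * u' x * v x + F x * V x) = k * (p t * V t - p s * V s) := by
  have hzi : IntegrableOn z (Ioo s t) :=
    (hF.const_mul k⁻¹).congr (heq.mono fun x hx => by
      simp only [← hx, inv_mul_cancel_left₀ hk])
  rw [← (hp.isPrimitiveOn hst hsub hz hzi).integral_mul_add_mul hV,
    ← intervalIntegral.integral_const_mul, intervalIntegral.integral_of_le hst.le,
    integral_Ioc_eq_integral_Ioo]
  refine integral_congr_ae ?_
  filter_upwards [heq, ae_restrict_of_ae_restrict_of_subset hsub hp.2] with x hx hpu
  rw [← hx, hpu]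
  ring

namespace Data

variable {P : Data} {ε : ℝ} {k : ℝ → ℝ}

variable (P) in
/-- The integrand of the bulk part of the weak formulation, with the phase indicator `k` in place
of `φ ε`. The choices `k = φ ε` and `k = χ` give the diffuse and the sharp problem. -/
noncomputable def bulkDensity (k : ℝ → ℝ) (u v : H1 P.Ω) (x : ℝ) : ℝ :=
  (P.α + (1 - P.α) * k x) * u.grad x * v.grad x +
    ((P.β + (P.γ - P.β) * k x) * u x - (P.h x + (P.q x - P.h x) * k x)) * v x

variable (P) in
/-- The residual of `u`, tested with `v`, in the weak form of the diffuse problem. -/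
noncomputable def diffuseResidual (ε : ℝ) (u v : H1 P.Ω) : ℝ :=
  (∫ x in P.Ω, P.bulkDensity (P.φ ε) u v x) +
    (P.κ * P.diffuseTrace ε u v + P.diffuseTrace ε P.g v)

variable (P) in
/-- The residual of `u`, tested with `v`, in the weak form of the two-sided problem. -/
noncomputable def sharpResidual (u v : H1 P.Ω) : ℝ :=
  (∫ x in P.Ω, P.bulkDensity P.χ u v x) + (P.κ * P.trace u v + P.trace P.g v)

section Integrability

lemma memLp_affine_mul (hk : MemLp k ⊤ (volume.restrict P.Ω)) (s t : ℝ) {A : ℝ → ℝ}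
    (hA : MemLp A 2 (volume.restrict P.Ω)) :
    MemLp (fun x => (s + t * k x) * A x) 2 (volume.restrict P.Ω) :=
  hA.mul' ((memLp_top_const s).add (hk.const_mul t))

lemma memLp_h : MemLp P.h 2 (volume.restrict P.Ω) := P.h_memLp

lemma memLp_q : MemLp P.q 2 (volume.restrict P.Ω) := P.q_memLp

lemma memLp_source (hk : MemLp k ⊤ (volume.restrict P.Ω)) :
    MemLp (fun x => P.h x + (P.q x - P.h x) * k x) 2 (volume.restrict P.Ω) :=
  memLp_h.add (hk.mul' (memLp_q.sub memLp_h))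

lemma integrable_bulkDensity (hk : MemLp k ⊤ (volume.restrict P.Ω)) (u v : H1 P.Ω) :
    Integrable (P.bulkDensity k u v) (volume.restrict P.Ω) :=
  ((memLp_affine_mul hk _ _ u.memLp_grad).integrable_mul v.memLp_grad).add
    (((memLp_affine_mul hk _ _ u.memLp).sub (memLp_source hk)).integrable_mul v.memLp)

end Integrability

lemma IsDiffuseSolution.diffuseResidual_eq_zero {u : H1 P.Ω} (hu : P.IsDiffuseSolution ε u)
    (v : H1 P.Ω) : P.diffuseResidual ε u v = 0 := by
  have hsource : Integrable (fun x => P.f ε x * v x) (volume.restrict P.Ω) :=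
    (memLp_source P.memLp_top_φ).integrable_mul v.memLp
  have hbulk := P.integrable_bulkDensity (P.memLp_top_φ (ε := ε)) u v
  have hu_trace := (integrable_abs_deriv_φ_mul ε u v).const_mul P.κ
  have hg_trace := integrable_abs_deriv_φ_mul ε P.g v
  have hsplit := integral_add' hbulk (hu_trace.add hg_trace)
  rw [integral_add' hu_trace hg_trace, integral_const_mul] at hsplit
  refine Eq.trans ?_ (sub_eq_zero.2 (hu v))
  simp only [diffuseResidual, diffuseTrace]
  rw [← hsplit, eq_sub_iff_add_eq,
    ← integral_add' (hbulk.add (hu_trace.add hg_trace)) hsource]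
  congr 1 with x
  simp only [bulkDensity, D, c, f, Pi.add_apply]
  ring

section SharpProblem

variable {u : H1 P.Ω}

lemma setIntegral_bulkDensity_eq {U : Set ℝ} {s t j : ℝ}
    {z p : ℝ → ℝ} (hst : s < t) (hs : P.a ≤ s) (ht : t ≤ P.b) (hsub : Ioo s t ⊆ U)
    (hp : IsContRep U u.grad p) (hz : HasWeakDeriv U u.grad z) (hk : ∀ x ∈ Ioo s t, k x = j)
    (hj : P.α + (1 - P.α) * j ≠ 0)
    (heq : ∀ᵐ x ∂volume.restrict U, -(P.α + (1 - P.α) * j) * z x +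
      (P.β + (P.γ - P.β) * j) * u x = P.h x + (P.q x - P.h x) * j) (v : H1 P.Ω) :
    ∫ x in Ioo s t, P.bulkDensity k u v x =
      (P.α + (1 - P.α) * j) * (p t * v.contRep t - p s * v.contRep s) := by
  have hΩ : Ioo s t ⊆ P.Ω := Ioo_subset_Ioo hs ht
  have hreaction : IntegrableOn
      (fun x => (P.β + (P.γ - P.β) * j) * u x - (P.h x + (P.q x - P.h x) * j)) (Ioo s t) :=
    (((u.memLp.const_mul _).sub (memLp_source (memLp_top_const j))).mono_measure
      (Measure.restrict_mono_set _ hΩ)).integrable one_le_two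
  rw [← hp.setIntegral_flux_eq hst hsub hz hj hreaction
    ((ae_restrict_of_ae_restrict_of_subset hsub heq).mono fun x hx => by linarith)
    ((v.isPrimitiveOn_contRep P.a_lt_b).mono hs hst.le ht)]
  refine integral_congr_ae ?_
  filter_upwards [ae_restrict_mem measurableSet_Ioo,
    ae_restrict_of_ae_restrict_of_subset hΩ (v.contRep_ae_eq P.a_lt_b)] with x hx hv
  rw [bulkDensity, hk x hx, hv]

lemma IsTwoSidedSolution.sharpResidual_eq_zero (hu : P.IsTwoSidedSolution u) (v : H1 P.Ω) :
    P.sharpResidual u v = 0 := by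
  obtain ⟨⟨z₁, hz₁, heq₁⟩, ⟨z₂, hz₂, heq₂⟩, w, gc, p₁, p₂, hw, hgc, hp₁, hp₂, ha₁, hb₁, ha, hb⟩ :=
    hu
  have hin : ∫ x in Ioo P.a₁ P.b₁, P.bulkDensity P.χ u v x =
      (P.α + (1 - P.α) * 1) * (p₁ P.b₁ * v.contRep P.b₁ - p₁ P.a₁ * v.contRep P.a₁) :=
    setIntegral_bulkDensity_eq P.a₁_lt P.a_lt.le P.b₁_lt.le Subset.rfl hp₁ hz₁
      (fun x hx => χ_of_mem hx) (by simp) (heq₁.mono fun x hx => by linarith) v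
  have hout {s t : ℝ} (hst : s < t) (hs : P.a ≤ s) (ht : t ≤ P.b) (hsub : Ioo s t ⊆ P.Ω₂) :
      ∫ x in Ioo s t, P.bulkDensity P.χ u v x =
        (P.α + (1 - P.α) * 0) * (p₂ t * v.contRep t - p₂ s * v.contRep s) :=
    setIntegral_bulkDensity_eq hst hs ht hsub hp₂ hz₂
      (fun x hx => χ_of_notMem fun h => (hsub hx).elim (fun h' => h.1.not_gt h'.2)
        fun h' => h.2.not_gt h'.1)
      (by simpa using P.α_pos.ne') (heq₂.mono fun x hx => by linarith) v
  have hint : IntegrableOn (P.bulkDensity P.χ u v) (Ioo P.a P.b) :=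
    integrable_bulkDensity P.memLp_top_χ u v
  have hw_eq := H1.contRep_eqOn P.a_lt_b hw
  have hg_eq := H1.contRep_eqOn P.a_lt_b hgc
  have ha₁_mem : P.a₁ ∈ Icc P.a P.b := ⟨P.a_lt.le, (P.a₁_lt.trans P.b₁_lt).le⟩
  have hb₁_mem : P.b₁ ∈ Icc P.a P.b := ⟨(P.a_lt.trans P.a₁_lt).le, P.b₁_lt.le⟩
  simp only [sharpResidual, trace]
  rw [hw_eq ha₁_mem, hw_eq hb₁_mem, hg_eq ha₁_mem, hg_eq hb₁_mem, Ω,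
    setIntegral_Ioo_eq_add P.a_lt.le (P.a₁_lt.trans P.b₁_lt).le hint,
    setIntegral_Ioo_eq_add P.a₁_lt.le P.b₁_lt.le (hint.mono_set (Ioo_subset_Ioo_left P.a_lt.le)),
    hin, hout P.a_lt le_rfl ha₁_mem.2 subset_union_left,
    hout P.b₁_lt hb₁_mem.1 le_rfl subset_union_right]
  linear_combination v.contRep P.a * ha + v.contRep P.b * hb - v.contRep P.a₁ * ha₁ -
    v.contRep P.b₁ * hb₁

end SharpProblem

end Data

lemma min_le_add_sub_mul {s t y : ℝ} (hy₀ : 0 ≤ y) (hy₁ : y ≤ 1) : min s t ≤ s + (t - s) * y := by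
  nlinarith [min_le_left s t, min_le_right s t]

namespace Data

variable {P : Data} {ε : ℝ}

section Consistency

lemma integral_bulkDensity_φ_sub_χ (ε : ℝ) (u v : H1 P.Ω) :
    (∫ x in P.Ω, P.bulkDensity (P.φ ε) u v x) - ∫ x in P.Ω, P.bulkDensity P.χ u v x =
      (∫ x in P.Ω, (P.φ ε x - P.χ x) * ((1 - P.α) * u.grad x) * v.grad x) +
        ∫ x in P.Ω, (P.φ ε x - P.χ x) * ((P.γ - P.β) * u x - (P.q x - P.h x)) * v x := by
  have hgrad : Integrable (fun x => (P.φ ε x - P.χ x) * ((1 - P.α) * u.grad x) * v.grad x)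
      (volume.restrict P.Ω) :=
    (memLp_φ_sub_χ_mul (u.memLp_grad.const_mul _) ε).integrable_mul v.memLp_grad
  have hval : Integrable
      (fun x => (P.φ ε x - P.χ x) * ((P.γ - P.β) * u x - (P.q x - P.h x)) * v x)
      (volume.restrict P.Ω) :=
    (memLp_φ_sub_χ_mul ((u.memLp.const_mul _).sub (memLp_q.sub memLp_h)) ε).integrable_mul v.memLp
  rw [← integral_sub (integrable_bulkDensity P.memLp_top_φ u v)
    (integrable_bulkDensity P.memLp_top_χ u v), ← integral_add hgrad hval]
  congr 1 with x
  simp only [bulkDensity]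
  ring

lemma tendstoZeroInDual_integral_bulkDensity_sub (u : H1 P.Ω) :
    TendstoZeroInDual (fun ε v =>
      (∫ x in P.Ω, P.bulkDensity (P.φ ε) u v x) - ∫ x in P.Ω, P.bulkDensity P.χ u v x)
      (𝓝[>] 0) := by
  have hA : MemLp (fun x => (1 - P.α) * u.grad x) 2 (volume.restrict P.Ω) :=
    u.memLp_grad.const_mul _
  have hB : MemLp (fun x => (P.γ - P.β) * u x - (P.q x - P.h x)) 2 (volume.restrict P.Ω) :=
    (u.memLp.const_mul _).sub (memLp_q.sub memLp_h)
  refine ⟨_, by simpa using (tendsto_phaseError hA).add (tendsto_phaseError hB),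
    .of_forall fun ε v => ?_⟩
  simp only [integral_bulkDensity_φ_sub_χ, add_mul]
  exact (abs_add_le _ _).trans (add_le_add
    ((abs_integral_mul_le (memLp_φ_sub_χ_mul hA ε) v.memLp_grad).trans
      (mul_le_mul_of_nonneg_left v.sqrt_integral_grad_sq_le_norm (Real.sqrt_nonneg _)))
    ((abs_integral_mul_le (memLp_φ_sub_χ_mul hB ε) v.memLp).trans
      (mul_le_mul_of_nonneg_left v.sqrt_integral_sq_le_norm (Real.sqrt_nonneg _))))

lemma tendstoZeroInDual_diffuseResidual_sub_sharpResidual (u : H1 P.Ω) :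
    TendstoZeroInDual (fun ε v => P.diffuseResidual ε u v - P.sharpResidual u v) (𝓝[>] 0) := by
  convert (tendstoZeroInDual_integral_bulkDensity_sub u).add
    (((tendstoZeroInDual_diffuseTrace_sub_trace u).const_mul P.κ).add
      (tendstoZeroInDual_diffuseTrace_sub_trace P.g)) using 3 with ε v
  simp only [diffuseResidual, sharpResidual]
  ring

end Consistency

section Coercivity

variable (P) in
/-- A lower bound for the coefficients `D_ε` and `c_ε`, uniform in `ε`. -/
noncomputable def ellipticity : ℝ := min (min P.α 1) (min P.β P.γ)

variable (P) in
lemma ellipticity_pos : 0 < P.ellipticity :=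
  lt_min (lt_min P.α_pos one_pos) (lt_min P.β_pos P.γ_pos)

lemma ellipticity_le_D (ε x : ℝ) : P.ellipticity ≤ P.D ε x :=
  (min_le_left _ _).trans (min_le_add_sub_mul (P.φ_nonneg ε x) (P.φ_le_one ε x))

lemma ellipticity_le_c (ε x : ℝ) : P.ellipticity ≤ P.c ε x :=
  (min_le_right _ _).trans (min_le_add_sub_mul (P.φ_nonneg ε x) (P.φ_le_one ε x))

lemma ellipticity_mul_sq_norm_le_integral_bulkDensity (ε : ℝ) (u w : H1 P.Ω) :
    P.ellipticity * (u - w).norm ^ 2 ≤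
      (∫ x in P.Ω, P.bulkDensity (P.φ ε) u (u - w) x) -
        ∫ x in P.Ω, P.bulkDensity (P.φ ε) w (u - w) x := by
  have hu := integrable_bulkDensity (P.memLp_top_φ (ε := ε)) u (u - w)
  have hw := integrable_bulkDensity (P.memLp_top_φ (ε := ε)) w (u - w)
  have hval := (u - w).memLp.integrable_sq
  have hgrad := (u - w).memLp_grad.integrable_sq
  rw [H1.sq_norm, ← integral_add hval hgrad, ← integral_const_mul, ← integral_sub hu hw]
  refine integral_mono ((hval.add hgrad).const_mul _) (hu.sub hw) fun x => ?_
  have hD := mul_le_mul_of_nonneg_right (P.ellipticity_le_D ε x) (sq_nonneg ((u - w).grad x))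
  have hc := mul_le_mul_of_nonneg_right (P.ellipticity_le_c ε x) (sq_nonneg ((u - w) x))
  simp only [bulkDensity, H1.sub_apply, H1.grad_sub, D, c] at hD hc ⊢
  linarith

lemma diffuseTrace_le_diffuseTrace (ε : ℝ) (u w : H1 P.Ω) :
    P.diffuseTrace ε w (u - w) ≤ P.diffuseTrace ε u (u - w) := by
  refine integral_mono (integrable_abs_deriv_φ_mul ε w _) (integrable_abs_deriv_φ_mul ε u _)
    fun x => ?_
  have hsq := mul_nonneg (abs_nonneg (deriv (P.φ ε) x)) (sq_nonneg (u x - w x))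
  simp only [H1.sub_apply]
  linarith

lemma ellipticity_mul_sq_norm_le (ε : ℝ) (u w : H1 P.Ω) :
    P.ellipticity * (u - w).norm ^ 2 ≤
      P.diffuseResidual ε u (u - w) - P.diffuseResidual ε w (u - w) := by
  have hbulk := ellipticity_mul_sq_norm_le_integral_bulkDensity ε u w
  have htrace := mul_le_mul_of_nonneg_left (diffuseTrace_le_diffuseTrace ε u w) P.κ_nonneg
  simp only [diffuseResidual]
  linarith

lemma IsDiffuseSolution.norm_sub_le {u w : H1 P.Ω} {δ : ℝ} (hu : P.IsDiffuseSolution ε u)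
    (hw : ∀ v, |P.diffuseResidual ε w v| ≤ δ * v.norm) :
    (u - w).norm ≤ |δ| / P.ellipticity := by
  have hsq : P.ellipticity * (u - w).norm ^ 2 ≤ |δ| * (u - w).norm :=
    calc P.ellipticity * (u - w).norm ^ 2
        ≤ P.diffuseResidual ε u (u - w) - P.diffuseResidual ε w (u - w) :=
          ellipticity_mul_sq_norm_le ε u w
      _ ≤ |P.diffuseResidual ε w (u - w)| := by
          rw [hu.diffuseResidual_eq_zero, zero_sub]
          exact neg_le_abs _
      _ ≤ |δ| * (u - w).norm :=
          (hw _).trans (mul_le_mul_of_nonneg_right (le_abs_self δ) (u - w).norm_nonneg)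
  rw [le_div_iff₀' P.ellipticity_pos]
  rcases (u - w).norm_nonneg.eq_or_lt with hzero | hpos
  · rw [← hzero, mul_zero]
    exact abs_nonneg δ
  · exact le_of_mul_le_mul_right (by rwa [mul_assoc, ← sq]) hpos

end Coercivity

end Data

end DiffuseDomain

theorem mainTheorem4_general {P : DiffuseDomain.Data} {u₀ : DiffuseDomain.H1 P.Ω}
    (hu₀ : P.IsTwoSidedSolution u₀) {ι : Type*} {l : Filter ι} {ε : ι → ℝ}
    (hε : Tendsto ε l (𝓝[>] 0)) {u : ι → DiffuseDomain.H1 P.Ω}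
    (hu : ∀ i, P.IsDiffuseSolution (ε i) (u i)) :
    Tendsto (fun i => (u i).dist u₀) l (𝓝 0) := by
  obtain ⟨δ, hδ, hres⟩ :=
    DiffuseDomain.Data.tendstoZeroInDual_diffuseResidual_sub_sharpResidual u₀
  simp only [hu₀.sharpResidual_eq_zero, sub_zero] at hres
  have hbound : ∀ᶠ i in l, (u i).dist u₀ ≤ |δ (ε i)| / P.ellipticity :=
    (hε.eventually hres).mono fun i hi => (hu i).norm_sub_le hi
  refine squeeze_zero' (.of_forall fun i => Real.sqrt_nonneg _) hbound ?_
  simpa using ((hδ.comp hε).abs.div_const P.ellipticity)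

theorem mainTheorem4 (P : DiffuseDomain.Data)
    (u₀ : DiffuseDomain.H1 P.Ω) (hu₀ : P.IsTwoSidedSolution u₀)
    (ε : ℕ → ℝ) (hε : ∀ k, ε k ∈ Set.Ioo (0 : ℝ) 1)
    (hε_lim : Filter.Tendsto ε Filter.atTop (nhds 0))
    (u : ℕ → DiffuseDomain.H1 P.Ω) (hu : ∀ k, P.IsDiffuseSolution (ε k) (u k)) :
    ∃ σ : ℕ → ℕ, StrictMono σ ∧
      Filter.Tendsto (fun j => DiffuseDomain.H1.dist (u (σ j)) u₀) Filter.atTop (nhds 0) :=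
  ⟨id, strictMono_id, mainTheorem4_general hu₀
    (tendsto_nhdsWithin_iff.2 ⟨hε_lim, .of_forall fun k => (hε k).1⟩) hu⟩
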